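/- For a nonempty closed convex set $C\subseteq\mathbb{R}^2$ (with the Euclidean norm), let $P_C(x)$ denote the unique point of $C$ nearest to $x$, and let $R_C = 2P_C-\mathrm{Id}$. For two nonempty closed convex sets $A,B\subseteq\mathbb{R}^2$, the Douglas--Rachford operator of the ordered pair $(A,B)$ is $T_{DR}=\frac12(\mathrm{Id}+R_B\circ R_A)$, with fixed point set $\mathrm{Fix}\,T_{DR}=\{x\in\mathbb{R}^2 : T_{DR}(x)=x\}$. A set is called polyhedral at $x$ if there is a neighbourhood of $x$ in which it coincides with some polyhedral set, that is, with an intersection of finitely many closed halfspaces. Corollary 3. Let $A,B\subseteq\mathbb{R}^2$ be two closed convex sets with more than one common point such that $A$ and $B$ are both polyhedral at every point of $\mathrm{bdry}\,A\cap\mathrm{bdry}\,B$ (if any). Then, for any starting point $x_0\in\mathbb{R}^2$, the Douglas--Rachford method $x_{n+1}=T_{DR}(x_n)$ applied to $(A,B)$ converges in finitely many iterations to a point of $\mathrm{Fix}\,T_{DR}$, i.e. there is an $n\in\mathbb{N}$ (which may depend on $x_0$) such that $T_{DR}^n(x_0)\in\mathrm{Fix}\,T_{DR}$. -/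

import Mathlib

noncomputable section

/-- `p` is a nearest point of `C` to `x`: `p ∈ C` and `‖x - p‖ ≤ ‖x - u‖` for all `u ∈ C`. -/
def IsNearestPoint {E : Type*} [NormedAddCommGroup E] (C : Set E) (x p : E) : Prop :=
  p ∈ C ∧ ∀ u ∈ C, ‖x - p‖ ≤ ‖x - u‖

open Classical in
/-- The projection `P_C(x)`: the nearest point of `C` to `x`. It exists and is unique when `C` is
a nonempty closed convex set in a real Hilbert space (see `projOnto_eq_iff`);
the value is `x`, without significance, if there is no nearest point. -/
def projOnto {E : Type*} [NormedAddCommGroup E] (C : Set E) (x : E) : E :=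
  if h : ∃ p, IsNearestPoint C x p then h.choose else x

/-- On a nonempty closed convex set, `projOnto C x` is the unique nearest point of `C` to `x`. -/
theorem projOnto_eq_iff {E : Type*} [NormedAddCommGroup E] [InnerProductSpace ℝ E]
    [CompleteSpace E] {C : Set E} (hne : C.Nonempty) (hcl : IsClosed C) (hcv : Convex ℝ C)
    (x p : E) : projOnto C x = p ↔ IsNearestPoint C x p := by
  have key : ∀ q : E, IsNearestPoint C x q ↔ q ∈ C ∧ ∀ w ∈ C, inner ℝ (x - q) (w - q) ≤ 0 := by
    intro q
    refine and_congr_right fun hq => ?_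
    rw [← norm_eq_iInf_iff_real_inner_le_zero hcv hq]
    have : Nonempty C := ⟨⟨q, hq⟩⟩
    have hb : BddBelow (Set.range fun w : C => ‖x - w‖) :=
      ⟨0, by rintro _ ⟨w, rfl⟩; exact norm_nonneg _⟩
    constructor
    · intro h
      exact le_antisymm (le_ciInf fun w => h w w.2) (ciInf_le hb ⟨q, hq⟩)
    · intro h u hu
      rw [h]
      exact ciInf_le hb ⟨u, hu⟩
  have hex : ∃ q, IsNearestPoint C x q := by
    obtain ⟨v, hv, h⟩ := exists_norm_eq_iInf_of_complete_convex hne hcl.isComplete hcv x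
    exact ⟨v, (key v).2 ⟨hv, (norm_eq_iInf_iff_real_inner_le_zero hcv hv).1 h⟩⟩
  have huniq : ∀ q r, IsNearestPoint C x q → IsNearestPoint C x r → q = r := by
    intro q r hq hr
    have h1 := ((key q).1 hq).2 r hr.1
    have h2 := ((key r).1 hr).2 q hq.1
    have h3 : inner ℝ (q - r) (q - r) = inner ℝ (x - q) (r - q) + inner ℝ (x - r) (q - r) := by
      rw [← neg_sub q r, inner_neg_right, ← sub_eq_neg_add, ← inner_sub_left]
      congr 1
      abel
    exact sub_eq_zero.1 (real_inner_self_nonpos.1 (by rw [h3]; linarith))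
  have hspec : IsNearestPoint C x (projOnto C x) := by
    rw [projOnto, dif_pos hex]
    exact hex.choose_spec
  exact ⟨fun h => h ▸ hspec, fun h => huniq _ _ hspec h⟩

/-- The reflection operator `R_C = 2 P_C - Id`. -/
def reflectionOnto {E : Type*} [NormedAddCommGroup E] [InnerProductSpace ℝ E]
    (C : Set E) (x : E) : E :=
  (2 : ℝ) • projOnto C x - x

/-- The Douglas–Rachford operator `T_DR = (Id + R_B ∘ R_A) / 2` of the ordered pair `(A, B)`. -/
def douglasRachford {E : Type*} [NormedAddCommGroup E] [InnerProductSpace ℝ E]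
    (A B : Set E) (x : E) : E :=
  (1 / 2 : ℝ) • (x + reflectionOnto B (reflectionOnto A x))

/-- A polyhedral set: an intersection of finitely many closed halfspaces
`{y | ⟪a, y⟫ ≤ b}` (the whole space being the intersection of none). -/
def IsPolyhedralSet {E : Type*} [NormedAddCommGroup E] [InnerProductSpace ℝ E]
    (D : Set E) : Prop :=
  ∃ H : Finset (E × ℝ), D = {y | ∀ h ∈ H, inner ℝ h.1 y ≤ h.2}

/-- `S` is polyhedral at `x`: in some neighbourhood of `x` it coincides with a polyhedral set. -/
def IsPolyhedralAt {E : Type*} [NormedAddCommGroup E] [InnerProductSpace ℝ E]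
    (S : Set E) (x : E) : Prop :=
  ∃ U ∈ nhds x, ∃ D : Set E, IsPolyhedralSet D ∧ S ∩ U = D ∩ U

end

/-!
The Douglas–Rachford operator `T` of `(A, B)` is firmly nonexpansive and fixes `A ∩ B`, so its
iterates converge to a fixed point `x` (`FirmlyNonexpansive.exists_tendsto_iterate`). Put
`p = P_A x` and `v = x - p`. Then `p ∈ A ∩ B`, and `v` and `-v` are normal at `p` to `A` and `B`.

If `p` is interior to one of the sets, then `v = 0`, one projection is eventually the identity along
the iteration, and the other one lands in `A ∩ B`. Otherwise both sets are polyhedral at `p`. For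
`q ∈ A ∩ B` with `q ≠ p` the vector `d = q - p` is orthogonal to `v`, and for small `y` one has
`T (x + y) = x + F y`, where `F` is the Douglas–Rachford operator of the two critical cones, that is,
of the parts of the tangent cones at `p` that are orthogonal to `v` (`exists_cone_projOnto_add`).
Both cones contain `d`, so `F d = d`.

It remains to show that an orbit of `F` that tends to `0` reaches a fixed point
(`IsConicalStep.exists_map_eq_self`). For cones, `F` is positively homogeneous and `F y` is orthogonal
to `y - F y`: each step turns `y` by some angle `θ ≤ π / 2` and scales it by `cos θ`. Hence `F` has
no eigenvalues but `0` and `1`, and firm nonexpansiveness shows that an eigenvector has no acute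
angle with the terms of the orbit after the first (`IsConicalStep.inner_orbit_le_zero`). Suppose
that no term is fixed. Two consecutive terms make an acute angle, so there is no eigenvector in the
sector between them, and by continuity the orbit always turns in the same sense
(`IsConicalStep.planeDet_mul_pos`). As `d` confines it to a half-plane, its directions converge. By
homogeneity the limit direction is an eigenvector, and it has acute angles with late terms, a
contradiction (`IsConicalStep.not_tendsto_smul`).
-/

/-! ### Projections and the Douglas–Rachford operator -/

section Projection

variable {E : Type*} [NormedAddCommGroup E] [InnerProductSpace ℝ E]

theorem isNearestPoint_of_inner_le_zero {C : Set E} {x p : E} (hp : p ∈ C)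
    (h : ∀ w ∈ C, inner ℝ (x - p) (w - p) ≤ 0) : IsNearestPoint C x p := by
  refine ⟨hp, fun w hw => ?_⟩
  have h1 : x - w = (x - p) - (w - p) := by abel
  have h2 := norm_sub_sq_real (x - p) (w - p)
  rw [← h1] at h2
  have := h w hw
  exact (sq_le_sq₀ (norm_nonneg _) (norm_nonneg _)).1 (by nlinarith [sq_nonneg ‖w - p‖])

theorem douglasRachford_eq (A B : Set E) (x : E) :
    douglasRachford A B x =
      x + projOnto B ((2 : ℝ) • projOnto A x - x) - projOnto A x := by
  simp only [douglasRachford, reflectionOnto]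
  module

theorem douglasRachford_eq_self_iff {A B : Set E} {x : E} :
    douglasRachford A B x = x ↔ projOnto B ((2 : ℝ) • projOnto A x - x) = projOnto A x := by
  rw [douglasRachford_eq, add_sub_assoc, add_eq_left, sub_eq_zero]

variable [CompleteSpace E]

theorem projOnto_mem {C : Set E} (hne : C.Nonempty) (hcl : IsClosed C) (hcv : Convex ℝ C)
    (x : E) : projOnto C x ∈ C :=
  ((projOnto_eq_iff hne hcl hcv x _).1 rfl).1

theorem projOnto_eq_of_inner_le_zero {C : Set E} (hcl : IsClosed C) (hcv : Convex ℝ C)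
    {x p : E} (hp : p ∈ C) (h : ∀ w ∈ C, inner ℝ (x - p) (w - p) ≤ 0) : projOnto C x = p :=
  (projOnto_eq_iff ⟨p, hp⟩ hcl hcv x p).2 (isNearestPoint_of_inner_le_zero hp h)

theorem inner_sub_projOnto_le_zero {C : Set E} (hcl : IsClosed C) (hcv : Convex ℝ C)
    (x : E) {w : E} (hw : w ∈ C) : inner ℝ (x - projOnto C x) (w - projOnto C x) ≤ 0 := by
  have hne : C.Nonempty := ⟨w, hw⟩
  obtain ⟨v, hv, h⟩ := exists_norm_eq_iInf_of_complete_convex hne hcl.isComplete hcv x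
  have h' := (norm_eq_iInf_iff_real_inner_le_zero hcv hv).1 h
  rw [projOnto_eq_of_inner_le_zero hcl hcv hv h']
  exact h' w hw

theorem projOnto_of_mem {C : Set E} (hcl : IsClosed C) (hcv : Convex ℝ C) {x : E} (hx : x ∈ C) :
    projOnto C x = x :=
  projOnto_eq_of_inner_le_zero hcl hcv hx (by simp)

theorem projOnto_firmlyNonexpansive {C : Set E} (hne : C.Nonempty) (hcl : IsClosed C)
    (hcv : Convex ℝ C) (x y : E) :
    0 ≤ inner ℝ (projOnto C x - projOnto C y) ((x - projOnto C x) - (y - projOnto C y)) := by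
  have h1 := inner_sub_projOnto_le_zero hcl hcv x (projOnto_mem hne hcl hcv y)
  have h2 := inner_sub_projOnto_le_zero hcl hcv y (projOnto_mem hne hcl hcv x)
  have h3 : inner ℝ (projOnto C x - projOnto C y) ((x - projOnto C x) - (y - projOnto C y)) =
      - inner ℝ (x - projOnto C x) (projOnto C y - projOnto C x)
      - inner ℝ (y - projOnto C y) (projOnto C x - projOnto C y) := by
    rw [← neg_sub (projOnto C x) (projOnto C y), inner_neg_right, inner_sub_right,
      real_inner_comm (x - _), real_inner_comm (y - _)]
    ring
  linarith

theorem douglasRachford_of_mem_inter {A B : Set E} (hA : IsClosed A) (hA' : Convex ℝ A)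
    (hB : IsClosed B) (hB' : Convex ℝ B) {x : E} (hx : x ∈ A ∩ B) :
    douglasRachford A B x = x := by
  rw [douglasRachford_eq_self_iff, projOnto_of_mem hA hA' hx.1, two_smul, add_sub_cancel_right,
    projOnto_of_mem hB hB' hx.2]

theorem douglasRachford_firmlyNonexpansive {A B : Set E} (hAne : A.Nonempty) (hA : IsClosed A)
    (hA' : Convex ℝ A) (hBne : B.Nonempty) (hB : IsClosed B) (hB' : Convex ℝ B) (x y : E) :
    0 ≤ inner ℝ (douglasRachford A B x - douglasRachford A B y)
      ((x - douglasRachford A B x) - (y - douglasRachford A B y)) := by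
  have h1 := projOnto_firmlyNonexpansive hAne hA hA' x y
  have h2 := projOnto_firmlyNonexpansive hBne hB hB' ((2 : ℝ) • projOnto A x - x)
    ((2 : ℝ) • projOnto A y - y)
  simp only [douglasRachford_eq]
  set a := projOnto A x
  set c := projOnto A y
  set b := projOnto B ((2 : ℝ) • a - x)
  set e := projOnto B ((2 : ℝ) • c - y)
  -- Both displacements are linear in the increments of the two projections.
  have h3 : inner ℝ (x + b - a - (y + e - c)) ((x - (x + b - a)) - (y - (y + e - c))) =
      inner ℝ (a - c) ((x - a) - (y - c)) +
      inner ℝ (b - e) (((2 : ℝ) • a - x - b) - ((2 : ℝ) • c - y - e)) := by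
    have e1 : x + b - a - (y + e - c) = (x - y) + (b - e) - (a - c) := by abel
    have e2 : (x - (x + b - a)) - (y - (y + e - c)) = (a - c) - (b - e) := by abel
    have e3 : (x - a) - (y - c) = (x - y) - (a - c) := by abel
    have e4 : ((2 : ℝ) • a - x - b) - ((2 : ℝ) • c - y - e) =
        (2 : ℝ) • (a - c) - (x - y) - (b - e) := by module
    rw [e1, e2, e3, e4]
    generalize x - y = u, b - e = v, a - c = w
    simp only [inner_add_left, inner_sub_left, inner_sub_right, inner_smul_right]
    rw [real_inner_comm u w, real_inner_comm v w, real_inner_comm u v]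
    ring
  linarith

end Projection

/-! ### Firmly nonexpansive maps -/

section FirmlyNonexpansive

variable {E : Type*} [NormedAddCommGroup E] [InnerProductSpace ℝ E]

/-- `F` is firmly nonexpansive: `⟪F x - F y, (Id - F) x - (Id - F) y⟫ ≥ 0` for all `x`, `y`. -/
def FirmlyNonexpansive (F : E → E) : Prop :=
  ∀ x y, 0 ≤ inner ℝ (F x - F y) ((x - F x) - (y - F y))

namespace FirmlyNonexpansive

variable {F : E → E}

theorem norm_sq_add_norm_sq_le (hF : FirmlyNonexpansive F) (x y : E) :
    ‖F x - F y‖ ^ 2 + ‖(x - F x) - (y - F y)‖ ^ 2 ≤ ‖x - y‖ ^ 2 := by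
  have h := norm_add_sq_real (F x - F y) ((x - F x) - (y - F y))
  have h1 : F x - F y + ((x - F x) - (y - F y)) = x - y := by abel
  rw [h1] at h
  linarith [hF x y]

theorem norm_sub_le (hF : FirmlyNonexpansive F) (x y : E) : ‖F x - F y‖ ≤ ‖x - y‖ :=
  (sq_le_sq₀ (norm_nonneg _) (norm_nonneg _)).1
    (by nlinarith [hF.norm_sq_add_norm_sq_le x y, sq_nonneg ‖(x - F x) - (y - F y)‖])

theorem continuous (hF : FirmlyNonexpansive F) : Continuous F :=
  (LipschitzWith.of_dist_le_mul (K := 1) fun x y => by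
    simpa [dist_eq_norm] using hF.norm_sub_le x y).continuous

/-- In finite dimension the iterates of a firmly nonexpansive map with a fixed point converge
to a fixed point. -/
theorem exists_tendsto_iterate [FiniteDimensional ℝ E] (hF : FirmlyNonexpansive F) {z : E}
    (hz : F z = z) (x : E) :
    ∃ y, F y = y ∧ Filter.Tendsto (fun n => F^[n] x) Filter.atTop (nhds y) := by
  have step : ∀ {y : E}, F y = y → ∀ n, ‖F^[n + 1] x - y‖ ^ 2 + ‖F^[n] x - F^[n + 1] x‖ ^ 2 ≤
      ‖F^[n] x - y‖ ^ 2 := by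
    intro y hy n
    have h := hF.norm_sq_add_norm_sq_le (F^[n] x) y
    rwa [hy, sub_self, sub_zero, ← Function.iterate_succ_apply' F] at h
  have anti : ∀ {y : E}, F y = y → Antitone fun n => ‖F^[n] x - y‖ := by
    intro y hy
    refine antitone_nat_of_succ_le fun n => ?_
    exact (sq_le_sq₀ (norm_nonneg _) (norm_nonneg _)).1
      (by nlinarith [step hy n, sq_nonneg ‖F^[n] x - F^[n + 1] x‖])
  have : ProperSpace E := FiniteDimensional.proper ℝ E
  have hball : ∀ n, F^[n] x ∈ Metric.closedBall z ‖x - z‖ := fun n => by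
    rw [mem_closedBall_iff_norm]
    exact anti hz (Nat.zero_le n)
  obtain ⟨y, -, φ, hφ, hlim⟩ := (isCompact_closedBall z ‖x - z‖).tendsto_subseq hball
  -- The squared distances to `z` converge, so consecutive iterates approach each other.
  have hdiff : Filter.Tendsto (fun n => ‖F^[n] x - F^[n + 1] x‖ ^ 2) Filter.atTop (nhds 0) := by
    obtain ⟨l, hl⟩ : ∃ l, Filter.Tendsto (fun n => ‖F^[n] x - z‖) Filter.atTop (nhds l) :=
      ⟨_, tendsto_atTop_ciInf (anti hz) ⟨0, by rintro _ ⟨n, rfl⟩; exact norm_nonneg _⟩⟩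
    have h2 := (hl.pow 2).sub ((hl.comp (Filter.tendsto_add_atTop_nat 1)).pow 2)
    rw [sub_self] at h2
    refine squeeze_zero (fun n => sq_nonneg _) (fun n => ?_) h2
    simp only [Function.comp_apply]
    linarith [step hz n]
  have hy : F y = y := by
    have h1 : Filter.Tendsto (fun k => ‖F^[φ k] x - F (F^[φ k] x)‖ ^ 2) Filter.atTop
        (nhds (‖y - F y‖ ^ 2)) :=
      ((hlim.sub ((hF.continuous.tendsto y).comp hlim)).norm).pow 2
    have h2 : Filter.Tendsto (fun k => ‖F^[φ k] x - F (F^[φ k] x)‖ ^ 2) Filter.atTop (nhds 0) := by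
      simpa only [Function.comp_def, Function.iterate_succ_apply'] using
        hdiff.comp hφ.tendsto_atTop
    have h3 := tendsto_nhds_unique h1 h2
    rw [sq_eq_zero_iff, norm_eq_zero, sub_eq_zero] at h3
    exact h3.symm
  refine ⟨y, hy, ?_⟩
  rw [tendsto_iff_norm_sub_tendsto_zero]
  have h1 : Filter.Tendsto (fun n => ‖F^[n] x - y‖) Filter.atTop
      (nhds (⨅ n, ‖F^[n] x - y‖)) :=
    tendsto_atTop_ciInf (anti hy) ⟨0, by rintro _ ⟨n, rfl⟩; exact norm_nonneg _⟩
  have h2 := tendsto_iff_norm_sub_tendsto_zero.1 hlim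
  have h3 := tendsto_nhds_unique (h1.comp hφ.tendsto_atTop) h2
  rwa [h3] at h1

end FirmlyNonexpansive

end FirmlyNonexpansive

/-! ### Closed convex cones -/

section Cone

variable {E : Type*} [NormedAddCommGroup E] [InnerProductSpace ℝ E]

/-- `K` is a closed convex cone with apex `0`, and `0 ∈ K`. -/
structure IsClosedConvexCone (K : Set E) : Prop where
  isClosed : IsClosed K
  convex : Convex ℝ K
  zero_mem : (0 : E) ∈ K
  smul_mem : ∀ c : ℝ, 0 < c → ∀ k ∈ K, c • k ∈ K

/-- The face of `K` orthogonal to `v`. If `v` is a normal vector of a set at `p` and `K` is the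
tangent cone there, this is the critical cone: it governs the projection near `p + v`. -/
def orthogonalFace (K : Set E) (v : E) : Set E :=
  {k ∈ K | inner ℝ v k = 0}

namespace IsClosedConvexCone

variable {K L : Set E}

theorem face (hK : IsClosedConvexCone K) (v : E) :
    IsClosedConvexCone (orthogonalFace K v) where
  isClosed := hK.isClosed.inter (isClosed_eq (by fun_prop) continuous_const)
  convex x hx y hy a b ha hb hab := ⟨hK.convex hx.1 hy.1 ha hb hab, by
    rw [inner_add_right, inner_smul_right, inner_smul_right, hx.2, hy.2, mul_zero, mul_zero,
      add_zero]⟩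
  zero_mem := ⟨hK.zero_mem, inner_zero_right _⟩
  smul_mem c hc k hk := ⟨hK.smul_mem c hc k hk.1, by rw [inner_smul_right, hk.2, mul_zero]⟩

variable [CompleteSpace E]

theorem projOnto_mem (hK : IsClosedConvexCone K) (x : E) : projOnto K x ∈ K :=
  _root_.projOnto_mem ⟨0, hK.zero_mem⟩ hK.isClosed hK.convex x

theorem inner_projOnto_self (hK : IsClosedConvexCone K) (x : E) :
    inner ℝ (x - projOnto K x) (projOnto K x) = 0 := by
  have h0 := inner_sub_projOnto_le_zero hK.isClosed hK.convex x hK.zero_mem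
  have h2 := inner_sub_projOnto_le_zero hK.isClosed hK.convex x
    (hK.smul_mem 2 two_pos _ (hK.projOnto_mem x))
  rw [zero_sub, inner_neg_right] at h0
  rw [two_smul, add_sub_cancel_right] at h2
  linarith

theorem inner_sub_projOnto_le_zero (hK : IsClosedConvexCone K) (x : E) {k : E} (hk : k ∈ K) :
    inner ℝ (x - projOnto K x) k ≤ 0 := by
  have h := _root_.inner_sub_projOnto_le_zero hK.isClosed hK.convex x hk
  rwa [inner_sub_right, hK.inner_projOnto_self, sub_zero] at h

theorem projOnto_smul (hK : IsClosedConvexCone K) {c : ℝ} (hc : 0 < c) (x : E) :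
    projOnto K (c • x) = c • projOnto K x := by
  refine projOnto_eq_of_inner_le_zero hK.isClosed hK.convex
    (hK.smul_mem c hc _ (hK.projOnto_mem x)) fun w hw => ?_
  rw [← smul_sub, inner_smul_left, inner_sub_right, inner_smul_right, hK.inner_projOnto_self,
    mul_zero, sub_zero]
  exact mul_nonpos_of_nonneg_of_nonpos (by simpa using hc.le) (hK.inner_sub_projOnto_le_zero x hw)

theorem norm_sq_eq (hK : IsClosedConvexCone K) (x : E) :
    ‖x‖ ^ 2 = ‖x - projOnto K x‖ ^ 2 + ‖projOnto K x‖ ^ 2 := by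
  have h := norm_add_sq_real (x - projOnto K x) (projOnto K x)
  rwa [sub_add_cancel, hK.inner_projOnto_self, mul_zero, add_zero] at h

theorem norm_projOnto_le (hK : IsClosedConvexCone K) (x : E) : ‖projOnto K x‖ ≤ ‖x‖ :=
  (sq_le_sq₀ (norm_nonneg _) (norm_nonneg _)).1
    (by nlinarith [hK.norm_sq_eq x, sq_nonneg ‖x - projOnto K x‖])

theorem norm_sub_projOnto_le (hK : IsClosedConvexCone K) (x : E) : ‖x - projOnto K x‖ ≤ ‖x‖ :=
  (sq_le_sq₀ (norm_nonneg _) (norm_nonneg _)).1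
    (by nlinarith [hK.norm_sq_eq x, sq_nonneg ‖projOnto K x‖])

theorem douglasRachford_smul (hK : IsClosedConvexCone K) (hL : IsClosedConvexCone L) {c : ℝ}
    (hc : 0 < c) (x : E) : douglasRachford K L (c • x) = c • douglasRachford K L x := by
  rw [douglasRachford_eq, douglasRachford_eq, hK.projOnto_smul hc, smul_comm, ← smul_sub,
    hL.projOnto_smul hc, ← smul_add, ← smul_sub]

/-- For cones the step `x - T x` of the Douglas–Rachford operator is orthogonal to `T x`. -/
theorem inner_douglasRachford_sub (hK : IsClosedConvexCone K) (hL : IsClosedConvexCone L)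
    (x : E) :
    inner ℝ (douglasRachford K L x) (x - douglasRachford K L x) = 0 := by
  have h1 := hK.inner_projOnto_self x
  have h2 := hL.inner_projOnto_self ((2 : ℝ) • projOnto K x - x)
  rw [douglasRachford_eq]
  set a := projOnto K x
  set b := projOnto L ((2 : ℝ) • a - x)
  simp only [inner_add_left, inner_sub_left, inner_add_right, inner_sub_right,
    inner_smul_left] at h1 h2 ⊢
  rw [real_inner_comm x a, real_inner_comm x b] at *
  rw [real_inner_comm a b] at *
  simp only [RCLike.conj_to_real] at h2
  linarith

theorem douglasRachford_firmlyNonexpansive (hK : IsClosedConvexCone K)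
    (hL : IsClosedConvexCone L) : FirmlyNonexpansive (douglasRachford K L) :=
  _root_.douglasRachford_firmlyNonexpansive ⟨0, hK.zero_mem⟩ hK.isClosed hK.convex
    ⟨0, hL.zero_mem⟩ hL.isClosed hL.convex

end IsClosedConvexCone

end Cone

/-! ### Homogeneous firmly nonexpansive maps of the plane -/

section Plane

/-- The determinant of two plane vectors; it is positive when `y` lies counterclockwise of `x`. -/
def planeDet (x y : EuclideanSpace ℝ (Fin 2)) : ℝ := x 0 * y 1 - x 1 * y 0

/-- Rotation of the plane by a right angle, counterclockwise. -/
def quarterTurn (x : EuclideanSpace ℝ (Fin 2)) : EuclideanSpace ℝ (Fin 2) := !₂[-x 1, x 0]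

theorem plane_inner (x y : EuclideanSpace ℝ (Fin 2)) : inner ℝ x y = x 0 * y 0 + x 1 * y 1 := by
  simp [PiLp.inner_apply, Fin.sum_univ_two, mul_comm]

theorem inner_self_smul_eq (d x : EuclideanSpace ℝ (Fin 2)) :
    (inner ℝ d d : ℝ) • x = (inner ℝ d x : ℝ) • d + planeDet d x • quarterTurn d := by
  rw [plane_inner d d, plane_inner d x]
  ext i
  fin_cases i <;> simp [planeDet, quarterTurn] <;> ring

theorem inner_self_mul_planeDet (d x y : EuclideanSpace ℝ (Fin 2)) :
    inner ℝ d d * planeDet x y = inner ℝ d x * planeDet d y - planeDet d x * inner ℝ d y := by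
  simp only [plane_inner, planeDet]
  ring

theorem quarterTurn_ne_zero {d : EuclideanSpace ℝ (Fin 2)} (hd : d ≠ 0) : quarterTurn d ≠ 0 := by
  intro h
  apply hd
  have h0 := congrArg (fun z : EuclideanSpace ℝ (Fin 2) => z 0) h
  have h1 := congrArg (fun z : EuclideanSpace ℝ (Fin 2) => z 1) h
  simp [quarterTurn] at h0 h1
  ext i
  fin_cases i <;> simp [h0, h1]

theorem inner_quarterTurn (d : EuclideanSpace ℝ (Fin 2)) : inner ℝ d (quarterTurn d) = 0 := by
  simp [plane_inner, quarterTurn]; ring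

theorem continuous_planeDet {X : Type*} [TopologicalSpace X] {f g : X → EuclideanSpace ℝ (Fin 2)}
    (hf : Continuous f) (hg : Continuous g) : Continuous fun t => planeDet (f t) (g t) := by
  unfold planeDet
  fun_prop

theorem exists_eq_smul_of_planeDet_eq_zero {f g : EuclideanSpace ℝ (Fin 2)} (hf : f ≠ 0)
    (h : planeDet f g = 0) : ∃ c : ℝ, g = c • f := by
  have hff : inner ℝ f f ≠ 0 := inner_self_ne_zero.2 hf
  refine ⟨inner ℝ f g / inner ℝ f f, ?_⟩
  have h1 := inner_self_smul_eq f g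
  rw [h, zero_smul, add_zero] at h1
  rw [div_eq_inv_mul, mul_smul, ← h1, smul_smul, inv_mul_cancel₀ hff, one_smul]

/-- A positively homogeneous firmly nonexpansive map `F` whose step `x - F x` is always orthogonal
to `F x`: it turns `x` by some angle `θ ≤ π / 2` and scales it by `cos θ`. The Douglas–Rachford
operator of two closed convex cones is of this kind. -/
structure IsConicalStep {E : Type*} [NormedAddCommGroup E] [InnerProductSpace ℝ E]
    (F : E → E) : Prop where
  firm : FirmlyNonexpansive F
  smul : ∀ c : ℝ, 0 < c → ∀ x, F (c • x) = c • F x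
  inner_sub : ∀ x, inner ℝ (F x) (x - F x) = 0

namespace IsConicalStep

section General

variable {E : Type*} [NormedAddCommGroup E] [InnerProductSpace ℝ E] {F : E → E}

theorem map_zero (hF : IsConicalStep F) : F 0 = 0 := by
  have h := hF.inner_sub 0
  rw [zero_sub, inner_neg_right, neg_eq_zero] at h
  exact inner_self_eq_zero.1 h

theorem inner_le_inner_map (hF : IsConicalStep F) {f : E} (hf : F f = f) (x : E) :
    inner ℝ f x ≤ inner ℝ f (F x) := by
  have h := hF.firm x f
  rw [hf, sub_self, sub_zero, inner_sub_left, hF.inner_sub, inner_sub_right] at h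
  linarith

theorem inner_map_le_zero (hF : IsConicalStep F) {f : E} (hf : F f = 0) (x : E) :
    inner ℝ f (F x) ≤ 0 := by
  have h := hF.firm x f
  rw [hf, sub_zero, sub_zero, inner_sub_right, hF.inner_sub, real_inner_comm] at h
  linarith

/-- The only eigenvalues of `F` are `0` and `1`. -/
theorem eq_zero_or_eq_self (hF : IsConicalStep F) {f : E} {c : ℝ} (h : F f = c • f) :
    F f = 0 ∨ F f = f := by
  have h1 := hF.inner_sub f
  rw [h, inner_smul_left, inner_sub_right, inner_smul_right] at h1
  have h2 : c * ((1 - c) * inner ℝ f f) = 0 := by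
    simpa [sub_mul] using h1
  rcases mul_eq_zero.1 h2 with hc | hc
  · left; rw [h, hc, zero_smul]
  rcases mul_eq_zero.1 hc with hc | hc
  · right; rw [h, (sub_eq_zero.1 hc).symm, one_smul]
  · left; rw [inner_self_eq_zero.1 hc, hF.map_zero]

theorem monotone_inner (hF : IsConicalStep F) {y : ℕ → E} (hy : ∀ n, y (n + 1) = F (y n)) {f : E}
    (hf : F f = f) : Monotone fun n => inner ℝ f (y n) :=
  monotone_nat_of_le_succ fun n => by rw [hy]; exact hF.inner_le_inner_map hf (y n)

/-- An eigenvector of `F` has no acute angle with any term after the first of an orbit that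
tends to `0`. -/
theorem inner_orbit_le_zero (hF : IsConicalStep F) {y : ℕ → E} (hy : ∀ n, y (n + 1) = F (y n))
    (hlim : Filter.Tendsto y Filter.atTop (nhds 0)) {f : E} {c : ℝ} (hf : F f = c • f) (n : ℕ) :
    inner ℝ f (y (n + 1)) ≤ 0 := by
  rcases hF.eq_zero_or_eq_self hf with h | h
  · rw [hy]; exact hF.inner_map_le_zero h _
  · have hl : Filter.Tendsto (fun n => (inner ℝ f (y n) : ℝ)) Filter.atTop (nhds 0) := by
      simpa using (tendsto_const_nhds (x := f)).inner hlim
    exact (hF.monotone_inner hy h).ge_of_tendsto hl (n + 1)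

end General

variable {F : EuclideanSpace ℝ (Fin 2) → EuclideanSpace ℝ (Fin 2)}
  {y : ℕ → EuclideanSpace ℝ (Fin 2)}

/-- The directions of an orbit tending to `0` cannot converge: a limit direction would be an
eigenvector, and it would have acute angles with late terms of the orbit. -/
theorem not_tendsto_smul (hF : IsConicalStep F) (hy : ∀ n, y (n + 1) = F (y n))
    (hlim : Filter.Tendsto y Filter.atTop (nhds 0)) {c : ℕ → ℝ}
    (hc : ∀ᶠ n in Filter.atTop, 0 < c n) {w : EuclideanSpace ℝ (Fin 2)} (hw : w ≠ 0) :
    ¬ Filter.Tendsto (fun n => c n • y n) Filter.atTop (nhds w) := by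
  intro hcw
  have hdet : planeDet w (F w) = 0 := by
    have h1 := hcw.comp (Filter.tendsto_add_atTop_nat 1)
    have h2 : Filter.Tendsto
        (fun n => planeDet (c (n + 1) • y (n + 1)) (F (c n • y n))) Filter.atTop
        (nhds (planeDet w (F w))) := by
      have hcont : Continuous fun z : EuclideanSpace ℝ (Fin 2) × EuclideanSpace ℝ (Fin 2) =>
          planeDet z.1 (F z.2) :=
        continuous_planeDet continuous_fst (hF.firm.continuous.comp continuous_snd)
      exact (hcont.tendsto (w, w)).comp (h1.prodMk_nhds hcw)
    refine tendsto_nhds_unique h2 (tendsto_const_nhds.congr' ?_)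
    filter_upwards [hc] with n hn
    rw [hF.smul _ hn, ← hy]
    simp [planeDet]; ring
  obtain ⟨b, hb⟩ := exists_eq_smul_of_planeDet_eq_zero hw hdet
  have h3 : Filter.Tendsto (fun n => (inner ℝ w (c n • y n) : ℝ)) Filter.atTop
      (nhds (inner ℝ w w)) := tendsto_const_nhds.inner hcw
  have h4 : (inner ℝ w w : ℝ) ≤ 0 := by
    refine le_of_tendsto h3 ?_
    filter_upwards [hc, Filter.eventually_ge_atTop 1] with n hn hn1
    obtain ⟨m, rfl⟩ := Nat.exists_eq_add_of_le' hn1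
    rw [inner_smul_right]
    exact mul_nonpos_of_nonneg_of_nonpos hn.le (hF.inner_orbit_le_zero hy hlim hb m)
  exact hw (real_inner_self_nonpos.1 h4)

/-- Along an orbit that tends to `0` without reaching it, the sense of rotation does not change:
on the segment from `y (n + 1)` to `y (n + 2)` all vectors have acute angles with `y (n + 1)`, so
none of them is an eigenvector, and the determinant of `f` and `F f` has no zero there. -/
theorem planeDet_mul_pos (hF : IsConicalStep F) (hy : ∀ n, y (n + 1) = F (y n))
    (hlim : Filter.Tendsto y Filter.atTop (nhds 0)) (hne : ∀ n, y n ≠ 0) (n : ℕ) :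
    0 < planeDet (y (n + 1)) (y (n + 2)) * planeDet (y (n + 2)) (y (n + 3)) := by
  let f : ℝ → EuclideanSpace ℝ (Fin 2) := fun t => (1 - t) • y (n + 1) + t • y (n + 2)
  let g : ℝ → ℝ := fun t => planeDet (f t) (F (f t))
  have hfc : Continuous f := by fun_prop
  have hgc : Continuous g := continuous_planeDet hfc (hF.firm.continuous.comp hfc)
  have hg : ∀ t ∈ Set.Icc (0 : ℝ) 1, g t ≠ 0 := by
    intro t ht h0
    have h1 : inner ℝ (y (n + 2)) (y (n + 1)) = inner ℝ (y (n + 2)) (y (n + 2)) := by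
      have := hF.inner_sub (y (n + 1))
      rw [← hy, inner_sub_right] at this
      linarith
    have hpos : 0 < inner ℝ (f t) (y (n + 1)) := by
      have p1 : 0 < inner ℝ (y (n + 1)) (y (n + 1)) := real_inner_self_pos.2 (hne _)
      have p2 : 0 < inner ℝ (y (n + 2)) (y (n + 2)) := real_inner_self_pos.2 (hne _)
      simp only [f, inner_add_left, inner_smul_left, RCLike.conj_to_real, h1]
      rcases ht.1.eq_or_lt with rfl | h
      · simpa using p1
      · have := mul_nonneg (sub_nonneg.2 ht.2) p1.le
        have := mul_pos h p2
        linarith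
    have hf0 : f t ≠ 0 := fun h => by simp [h] at hpos
    obtain ⟨c, hc⟩ := exists_eq_smul_of_planeDet_eq_zero hf0 h0
    exact absurd (hF.inner_orbit_le_zero hy hlim hc n) (not_le.2 hpos)
  have e0 : g 0 = planeDet (y (n + 1)) (y (n + 2)) := by simp [g, f, ← hy]
  have e1 : g 1 = planeDet (y (n + 2)) (y (n + 3)) := by simp [g, f, ← hy]
  rw [← e0, ← e1]
  by_contra hle
  have h0 := hg 0 (by simp)
  have h1 := hg 1 (by simp)
  obtain ⟨t, ht, hgt⟩ : (0 : ℝ) ∈ g '' Set.Icc 0 1 := by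
    rcases mul_nonpos_iff.1 (not_lt.1 hle) with h | h
    · exact intermediate_value_Icc' zero_le_one hgc.continuousOn ⟨h.2, h.1⟩
    · exact intermediate_value_Icc zero_le_one hgc.continuousOn h
  exact hg t ht hgt

/-- An orbit tending to `0` stays in the half-plane `⟪d, y⟫ ≤ 0` of a fixed vector `d`. There it
cannot turn monotonically for ever, because its directions would converge. -/
theorem exists_map_eq_self (hF : IsConicalStep F) (hy : ∀ n, y (n + 1) = F (y n))
    (hlim : Filter.Tendsto y Filter.atTop (nhds 0)) {d : EuclideanSpace ℝ (Fin 2)} (hd : d ≠ 0)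
    (hFd : F d = d) : ∃ n, F (y n) = y n := by
  by_contra hcon
  have hne : ∀ n, y n ≠ 0 := fun n hn => hcon ⟨n, by rw [hn, hF.map_zero]⟩
  have hdd : (0 : ℝ) < inner ℝ d d := real_inner_self_pos.2 hd
  have hsign := hF.planeDet_mul_pos hy hlim hne
  -- `ε` is the sense of rotation.
  obtain ⟨ε, hε, hdet⟩ : ∃ ε : ℝ, ε * ε = 1 ∧
      ∀ n, 0 < ε * planeDet (y (n + 1)) (y (n + 2)) := by
    rcases lt_or_gt_of_ne (left_ne_zero_of_mul (hsign 0).ne') with h | h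
    · refine ⟨-1, by norm_num, fun n => ?_⟩
      induction n with
      | zero => linarith
      | succ n ih => linarith [(neg_iff_neg_of_mul_pos (hsign n)).1 (by linarith)]
    · refine ⟨1, by norm_num, fun n => ?_⟩
      induction n with
      | zero => linarith
      | succ n ih => linarith [(pos_iff_pos_of_mul_pos (hsign n)).1 (by linarith)]
  set s : ℕ → ℝ := fun n => -inner ℝ d (y (n + 1)) with hs
  set t : ℕ → ℝ := fun n => ε * planeDet d (y (n + 1)) with ht
  have hrep : ∀ n, (inner ℝ d d : ℝ) • y (n + 1) =
      (-s n) • d + t n • (ε • quarterTurn d) := fun n => by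
    rw [inner_self_smul_eq, smul_smul]
    simp only [hs, ht, neg_neg]
    congr 2
    linear_combination (-planeDet d (y (n + 1))) * hε
  have hst : ∀ n, s n * t (n + 1) < t n * s (n + 1) := fun n => by
    have h1 := mul_pos hdd (hdet n)
    have h2 := inner_self_mul_planeDet d (y (n + 1)) (y (n + 2))
    have h3 : inner ℝ d d * (ε * planeDet (y (n + 1)) (y (n + 2))) =
        t n * s (n + 1) - s n * t (n + 1) := by
      simp only [hs, ht]
      linear_combination ε * h2
    linarith
  have hs0 : ∀ n, 0 ≤ s n := fun n => by
    have := hF.inner_orbit_le_zero hy hlim (f := d) (c := 1) (by rw [hFd, one_smul]) n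
    simp only [hs]; linarith
  have hspos : ∀ n, 0 < s n := fun n => by
    refine (hs0 n).lt_of_ne fun h => ?_
    have h1 : s (n + 1) ≤ s n := neg_le_neg (hF.monotone_inner hy hFd (Nat.le_succ (n + 1)))
    have h2 : s (n + 1) = 0 := le_antisymm (h1.trans h.ge) (hs0 _)
    have := hst n
    rw [h2, ← h] at this
    simp at this
  have hanti : Antitone fun n => t n / s n := antitone_nat_of_succ_le fun n => by
    rw [div_le_div_iff₀ (hspos _) (hspos _)]
    linarith [hst n]
  have hy' : ∀ n, y (n + 1 + 1) = F (y (n + 1)) := fun n => hy (n + 1)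
  have hlim' : Filter.Tendsto (fun n => y (n + 1)) Filter.atTop (nhds 0) :=
    hlim.comp (Filter.tendsto_add_atTop_nat 1)
  rcases tendsto_atTop_of_antitone hanti with hbot | ⟨r, hr⟩
  · -- The slopes tend to `-∞`: the directions tend to `-ε • quarterTurn d`.
    have hneg : ∀ᶠ n in Filter.atTop, t n < 0 := by
      filter_upwards [hbot.eventually_lt_atBot 0] with n hn
      exact (div_neg_iff.1 hn).resolve_left (fun h => absurd h.2 (hspos n).not_gt) |>.1
    have hε0 : ε ≠ 0 := fun h => by simp [h] at hε
    refine hF.not_tendsto_smul (y := fun n => y (n + 1)) hy' hlim'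
      (c := fun n => (-t n)⁻¹ * inner ℝ d d) (w := -(ε • quarterTurn d)) ?_
      (neg_ne_zero.2 (smul_ne_zero hε0 (quarterTurn_ne_zero hd))) ?_
    · filter_upwards [hneg] with n hn
      exact mul_pos (inv_pos.2 (neg_pos.2 hn)) hdd
    · have h1 : Filter.Tendsto (fun n => (t n / s n)⁻¹ • d - ε • quarterTurn d) Filter.atTop
          (nhds ((0 : ℝ) • d - ε • quarterTurn d)) :=
        ((tendsto_inv_atBot_zero.comp hbot).smul_const d).sub_const _
      rw [zero_smul, zero_sub] at h1
      refine h1.congr' ?_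
      filter_upwards [hneg] with n hn
      rw [mul_smul, hrep, smul_add, smul_smul, smul_smul, sub_eq_add_neg, ← neg_one_smul ℝ (ε • _)]
      congr 2
      · rw [inv_div]; field_simp
      · rw [inv_neg, neg_mul, inv_mul_cancel₀ hn.ne]
  · -- The slopes have a limit `r`: the directions tend to `-d + r • ε • quarterTurn d`.
    refine hF.not_tendsto_smul (y := fun n => y (n + 1)) hy' hlim'
      (c := fun n => (s n)⁻¹ * inner ℝ d d) (w := -d + r • (ε • quarterTurn d))
      (Filter.Eventually.of_forall fun n => mul_pos (inv_pos.2 (hspos n)) hdd) ?_ ?_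
    · intro h
      have h1 := congrArg (fun z => (inner ℝ d z : ℝ)) h
      simp only [inner_add_right, inner_neg_right, inner_smul_right, inner_quarterTurn,
        inner_zero_right, mul_zero, add_zero] at h1
      linarith
    · refine ((hr.smul_const (ε • quarterTurn d)).const_add (-d)).congr fun n => ?_
      rw [mul_smul, hrep, smul_add, neg_smul, smul_neg, smul_smul _ (s n), smul_smul _ (t n),
        inv_mul_cancel₀ (hspos n).ne', one_smul, div_eq_inv_mul]

end IsConicalStep

end Plane

/-! ### Localisation at a limit of the iteration -/

section Localisation

/-- A closed convex set that is polyhedral at `p` has a closed convex tangent cone at `p` with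
which it coincides near `p`. -/
theorem IsPolyhedralAt.exists_tangentCone {E : Type*} [NormedAddCommGroup E]
    [InnerProductSpace ℝ E] {C : Set E} (hC : Convex ℝ C) {p : E} (hp : p ∈ C)
    (hpoly : IsPolyhedralAt C p) :
    ∃ K : Set E, IsClosedConvexCone K ∧ (∀ w ∈ C, w - p ∈ K) ∧
      ∃ r > 0, ∀ k ∈ K, ‖k‖ < r → p + k ∈ C := by
  obtain ⟨U, hU, D, ⟨H, rfl⟩, hD⟩ := hpoly
  have hpD : ∀ h ∈ H, inner ℝ h.1 p ≤ h.2 := by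
    have : p ∈ C ∩ U := ⟨hp, mem_of_mem_nhds hU⟩
    rw [hD] at this
    exact this.1
  -- The tangent cone is cut out by the halfspaces with `p` on their boundary.
  refine ⟨{k | ∀ h ∈ H, inner ℝ h.1 p = h.2 → inner ℝ h.1 k ≤ 0}, ⟨?_, ?_, ?_, ?_⟩, ?_, ?_⟩
  · have : {k : E | ∀ h ∈ H, inner ℝ h.1 p = h.2 → inner ℝ h.1 k ≤ 0} =
        ⋂ h ∈ H, ⋂ (_ : inner ℝ h.1 p = h.2), {k : E | inner ℝ h.1 k ≤ 0} := by
      ext k; simp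
    rw [this]
    exact isClosed_biInter fun h _ => isClosed_iInter fun _ =>
      isClosed_le (by fun_prop) continuous_const
  · intro x hx y hy a b ha hb _ h hh he
    rw [inner_add_right, inner_smul_right, inner_smul_right]
    exact add_nonpos (mul_nonpos_of_nonneg_of_nonpos ha (hx h hh he))
      (mul_nonpos_of_nonneg_of_nonpos hb (hy h hh he))
  · intro h _ _
    rw [inner_zero_right]
  · intro c hc k hk h hh he
    rw [inner_smul_right]
    exact mul_nonpos_of_nonneg_of_nonpos hc.le (hk h hh he)
  · intro w hw h hh he
    have hlim : Filter.Tendsto (fun t : ℝ => p + t • (w - p)) (nhdsWithin 0 (Set.Ioi 0))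
        (nhds p) := by
      have : Continuous fun t : ℝ => p + t • (w - p) := by fun_prop
      simpa using (this.tendsto 0).mono_left nhdsWithin_le_nhds
    obtain ⟨t, htU, ht⟩ := ((hlim.eventually_mem hU).and
      (Ioo_mem_nhdsGT (zero_lt_one' ℝ))).exists
    have hm : p + t • (w - p) ∈ C ∩ U := ⟨hC.add_smul_sub_mem hp hw ⟨ht.1.le, ht.2.le⟩, htU⟩
    rw [hD] at hm
    have h1 := hm.1 h hh
    rw [inner_add_right, he, inner_smul_right] at h1
    exact nonpos_of_mul_nonpos_right (by linarith) ht.1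
  · have hev : ∀ᶠ k in nhds (0 : E), p + k ∈ U ∧
        ∀ h ∈ H, inner ℝ h.1 p ≠ h.2 → inner ℝ h.1 (p + k) ≤ h.2 := by
      refine Filter.Eventually.and ?_ ((Filter.eventually_all_finset H).2 fun h hh => ?_)
      · have : Filter.Tendsto (fun k : E => p + k) (nhds 0) (nhds p) := by
          simpa using (continuous_const_add p).tendsto (0 : E)
        exact this.eventually_mem hU
      · by_cases he : inner ℝ h.1 p = h.2
        · exact Filter.Eventually.of_forall fun k hk => absurd he hk
        · have hlt : inner ℝ h.1 (p + 0) < h.2 := by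
            rw [add_zero]
            exact (hpD h hh).lt_of_ne he
          have hc : Continuous fun k : E => (inner ℝ h.1 (p + k) : ℝ) := by fun_prop
          filter_upwards [(hc.tendsto 0).eventually_lt_const hlt] with k hk _ using hk.le
    obtain ⟨r, hr, hball⟩ := Metric.eventually_nhds_iff.1 hev
    refine ⟨r, hr, fun k hk hkr => ?_⟩
    obtain ⟨h1, h2⟩ := hball (by simpa using hkr)
    have hm : p + k ∈ {y | ∀ h ∈ H, inner ℝ h.1 y ≤ h.2} ∩ U := by
      refine ⟨fun h hh => ?_, h1⟩
      by_cases he : inner ℝ h.1 p = h.2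
      · rw [inner_add_right, he]
        linarith [hk h hh he]
      · exact h2 h hh he
    rw [← hD] at hm
    exact hm.1

/-- Normals of the face `orthogonalFace K v` that are small enough become normals of the plane cone
`K` after adding `v`. If `-d ∈ K`, the face is a line, to which `m` is orthogonal. Otherwise the
members of `K` stay away from the direction `-d`, so that `⟪v, k⟫` outweighs `⟪m, k⟫`. -/
theorem exists_forall_inner_add_le_zero {K : Set (EuclideanSpace ℝ (Fin 2))}
    (hK : IsClosedConvexCone K) {v d : EuclideanSpace ℝ (Fin 2)} (hv : ∀ k ∈ K, inner ℝ v k ≤ 0)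
    (hd0 : d ≠ 0) (hd : d ∈ orthogonalFace K v) :
    ∃ δ > 0, ∀ m : EuclideanSpace ℝ (Fin 2), ‖m‖ < δ →
      (∀ k ∈ orthogonalFace K v, inner ℝ m k ≤ 0) → ∀ k ∈ K, inner ℝ (v + m) k ≤ 0 := by
  by_cases hv0 : v = 0
  · refine ⟨1, one_pos, fun m _ hm k hk => ?_⟩
    rw [hv0, zero_add]
    exact hm k ⟨hk, by rw [hv0, inner_zero_left]⟩
  have hvv : 0 < ‖v‖ ^ 2 := pow_pos (norm_pos_iff.2 hv0) 2
  -- `v` and `d` are orthogonal coordinate axes of the plane.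
  have hrep : ∀ k : EuclideanSpace ℝ (Fin 2), ∃ α β : ℝ, k = α • d + β • v := by
    intro k
    have hdv : inner ℝ d v = 0 := by rw [real_inner_comm]; exact hd.2
    have hdet : planeDet d v ≠ 0 := fun h => by
      obtain ⟨c, rfl⟩ := exists_eq_smul_of_planeDet_eq_zero hd0 h
      rw [inner_smul_right, mul_eq_zero] at hdv
      rcases hdv with hc | hc
      · exact hv0 (by rw [hc, zero_smul])
      · exact hd0 (inner_self_eq_zero.1 hc)
    refine ⟨planeDet k v / planeDet d v, planeDet d k / planeDet d v, ?_⟩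
    have h1 : planeDet d v • k = planeDet k v • d + planeDet d k • v := by
      ext i
      fin_cases i <;> simp [planeDet] <;> ring
    rw [div_eq_inv_mul, div_eq_inv_mul, mul_smul, mul_smul, ← smul_add, ← h1, smul_smul,
      inv_mul_cancel₀ hdet, one_smul]
  have hval : ∀ (m : EuclideanSpace ℝ (Fin 2)) (α β : ℝ), inner ℝ (v + m) (α • d + β • v) =
      α * inner ℝ m d + β * (‖v‖ ^ 2 + inner ℝ m v) := by
    intro m α β
    rw [inner_add_left, inner_add_right, inner_add_right]
    simp only [inner_smul_right, hd.2, real_inner_self_eq_norm_sq]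
    ring
  have hβ : ∀ α β : ℝ, α • d + β • v ∈ K → β ≤ 0 := by
    intro α β h
    have := hv _ h
    rw [inner_add_right, inner_smul_right, inner_smul_right, hd.2,
      real_inner_self_eq_norm_sq] at this
    exact nonpos_of_mul_nonpos_left (by linarith) hvv
  have hmv : ∀ m : EuclideanSpace ℝ (Fin 2), ‖m‖ < ‖v‖ / 2 →
      ‖v‖ ^ 2 / 2 ≤ ‖v‖ ^ 2 + inner ℝ m v := by
    intro m hm
    have h1 := neg_le_of_abs_le (abs_real_inner_le_norm m v)
    nlinarith [norm_nonneg v]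
  by_cases hdK : -d ∈ K
  · refine ⟨‖v‖ / 2, half_pos (norm_pos_iff.2 hv0), fun m hm hface k hk => ?_⟩
    obtain ⟨α, β, rfl⟩ := hrep k
    have h1 := hface d hd
    have h2 := hface (-d) ⟨hdK, by rw [inner_neg_right, hd.2, neg_zero]⟩
    rw [inner_neg_right] at h2
    have h3 : inner ℝ m d = 0 := by linarith
    rw [hval, h3, mul_zero, zero_add]
    exact mul_nonpos_of_nonpos_of_nonneg (hβ α β hk) (by linarith [hmv m hm])
  · obtain ⟨ε, hε, hball⟩ : ∃ ε > 0, ∀ β : ℝ, |β| < ε → -d + β • v ∉ K := by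
      have hc : Continuous fun β : ℝ => -d + β • v := by fun_prop
      have hn : Kᶜ ∈ nhds (-d + (0 : ℝ) • v) := by
        rw [zero_smul, add_zero]
        exact hK.isClosed.isOpen_compl.mem_nhds hdK
      obtain ⟨ε, hε, h⟩ := Metric.eventually_nhds_iff.1 ((hc.tendsto 0).eventually_mem hn)
      exact ⟨ε, hε, fun β hb => h (by simpa using hb)⟩
    have hdn : 0 < ‖d‖ := norm_pos_iff.2 hd0
    refine ⟨min (‖v‖ / 2) (ε * (‖v‖ ^ 2 / 2) / ‖d‖),
      lt_min (half_pos (norm_pos_iff.2 hv0)) (by positivity), fun m hm hface k hk => ?_⟩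
    obtain ⟨α, β, rfl⟩ := hrep k
    have h1 := hface d hd
    have h2 := hmv m (hm.trans_le (min_le_left _ _))
    rw [hval]
    rcases le_or_gt 0 α with hα | hα
    · exact add_nonpos (mul_nonpos_of_nonneg_of_nonpos hα h1)
        (mul_nonpos_of_nonpos_of_nonneg (hβ α β hk) (by linarith))
    · have h3 := hK.smul_mem (-α)⁻¹ (inv_pos.2 (neg_pos.2 hα)) _ hk
      rw [smul_add, smul_smul, smul_smul, inv_neg, neg_mul, inv_mul_cancel₀ hα.ne,
        neg_one_smul] at h3
      have h4 : ε ≤ |(-α⁻¹) * β| := not_lt.1 fun h => hball _ h h3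
      have h5 : ε * (-α) ≤ -β := by
        rw [abs_mul, abs_neg, abs_inv, abs_of_neg hα, abs_of_nonpos (hβ α β hk),
          inv_mul_eq_div, le_div_iff₀ (neg_pos.2 hα)] at h4
        exact h4
      have h6 : ‖m‖ * ‖d‖ < ε * (‖v‖ ^ 2 / 2) :=
        (lt_div_iff₀ hdn).1 (hm.trans_le (min_le_right _ _))
      have h7 := neg_le_of_abs_le (abs_real_inner_le_norm m d)
      have h8 : -β * (‖v‖ ^ 2 / 2) ≤ -β * (‖v‖ ^ 2 + inner ℝ m v) :=
        mul_le_mul_of_nonneg_left h2 (neg_nonneg.2 (hβ α β hk))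
      have h9 : ε * (-α) * (‖v‖ ^ 2 / 2) ≤ -β * (‖v‖ ^ 2 / 2) :=
        mul_le_mul_of_nonneg_right h5 (by positivity)
      have h10 : -α * (-inner ℝ m d) ≤ -α * (ε * (‖v‖ ^ 2 / 2)) :=
        mul_le_mul_of_nonneg_left (by linarith) (by linarith)
      linarith

/-- Near `p + v`, where `v` is a normal vector of `C` at `p`, the projection onto `C` is the
projection onto the critical cone, provided that `C` is polyhedral at `p` and that it contains
another point `p + d` on the supporting line orthogonal to `v`. -/
theorem exists_cone_projOnto_add {C : Set (EuclideanSpace ℝ (Fin 2))} (hcl : IsClosed C)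
    (hcv : Convex ℝ C) {p v d : EuclideanSpace ℝ (Fin 2)} (hp : p ∈ C)
    (hpoly : IsPolyhedralAt C p) (hv : ∀ w ∈ C, inner ℝ v (w - p) ≤ 0) (hd0 : d ≠ 0)
    (hd : p + d ∈ C) (hvd : inner ℝ v d = 0) :
    ∃ K, IsClosedConvexCone K ∧ d ∈ K ∧
      ∃ δ > 0, ∀ y, ‖y‖ < δ → projOnto C (p + v + y) = p + projOnto K y := by
  obtain ⟨K, hK, hCK, r, hr, hKC⟩ := hpoly.exists_tangentCone hcv hp
  have hvK : ∀ k ∈ K, inner ℝ v k ≤ 0 := by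
    intro k hk
    have hc : 0 < r / (2 * (‖k‖ + 1)) := by positivity
    have hsmall : ‖(r / (2 * (‖k‖ + 1))) • k‖ < r := by
      rw [norm_smul, Real.norm_of_nonneg hc.le, div_mul_eq_mul_div, div_lt_iff₀ (by positivity)]
      nlinarith [norm_nonneg k]
    have h := hv _ (hKC _ (hK.smul_mem _ hc k hk) hsmall)
    rw [add_sub_cancel_left, inner_smul_right] at h
    exact nonpos_of_mul_nonpos_right h hc
  have hdK : d ∈ orthogonalFace K v := ⟨by simpa using hCK _ hd, hvd⟩
  obtain ⟨δ, hδ, hnormal⟩ := exists_forall_inner_add_le_zero hK hvK hd0 hdK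
  have hF := hK.face v
  refine ⟨orthogonalFace K v, hF, hdK, min δ r, lt_min hδ hr, fun y hy => ?_⟩
  have hmem := hF.projOnto_mem y
  refine projOnto_eq_of_inner_le_zero hcl hcv
    (hKC _ hmem.1 ((hF.norm_projOnto_le y).trans_lt (hy.trans_le (min_le_right _ _))))
    fun w hw => ?_
  have h1 := hnormal (y - projOnto (orthogonalFace K v) y)
    ((hF.norm_sub_projOnto_le y).trans_lt (hy.trans_le (min_le_left _ _)))
    (fun k hk => hF.inner_sub_projOnto_le_zero y hk) (w - p) (hCK w hw)
  have h2 := hF.inner_projOnto_self y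
  have e1 : p + v + y - (p + projOnto (orthogonalFace K v) y) =
      v + (y - projOnto (orthogonalFace K v) y) := by abel
  rw [e1, ← sub_sub, inner_sub_right, inner_add_left v _ (projOnto _ y), h2, hmem.2]
  linarith

/-- A normal vector of a set at an interior point vanishes. -/
theorem eq_zero_of_mem_interior {E : Type*} [NormedAddCommGroup E] [InnerProductSpace ℝ E]
    {C : Set E} {p v : E} (hp : p ∈ interior C) (hv : ∀ w ∈ C, inner ℝ v (w - p) ≤ 0) :
    v = 0 := by
  have hc : Continuous fun t : ℝ => p + t • v := by fun_prop
  have hn : C ∈ nhds (p + (0 : ℝ) • v) := by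
    rw [zero_smul, add_zero]
    exact mem_interior_iff_mem_nhds.1 hp
  obtain ⟨t, htC, ht⟩ := ((((hc.tendsto 0).mono_left nhdsWithin_le_nhds).eventually_mem hn).and
    (self_mem_nhdsWithin : Set.Ioi (0 : ℝ) ∈ nhdsWithin 0 (Set.Ioi 0))).exists
  have h := hv _ htC
  rw [add_sub_cancel_left, inner_smul_right] at h
  exact real_inner_self_nonpos.1 (nonpos_of_mul_nonpos_right h ht)

/-- If the iterates converge to a common point `p` that is interior to `A` or to `B`, then one of
the two projections is eventually the identity, and the other one lands in `A ∩ B`. -/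
theorem exists_iterate_mem_fixedPoints_of_mem_interior {E : Type*} [NormedAddCommGroup E]
    [InnerProductSpace ℝ E] [CompleteSpace E] {A B : Set E} (hA : IsClosed A) (hA' : Convex ℝ A)
    (hB : IsClosed B) (hB' : Convex ℝ B) {p : E} (hp : p ∈ A ∩ B)
    (hint : p ∈ interior A ∨ p ∈ interior B) {x : E}
    (hlim : Filter.Tendsto (fun n => (douglasRachford A B)^[n] x) Filter.atTop (nhds p)) :
    ∃ n, (douglasRachford A B)^[n] x ∈ Function.fixedPoints (douglasRachford A B) := by
  have hlim1 := hlim.comp (Filter.tendsto_add_atTop_nat 1)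
  rcases hint with hint | hint
  · have hn := mem_interior_iff_mem_nhds.1 hint
    obtain ⟨n, h0, h1⟩ := ((hlim.eventually_mem hn).and (hlim1.eventually_mem hn)).exists
    simp only [Function.comp_apply] at h1
    refine ⟨n + 1, douglasRachford_of_mem_inter hA hA' hB hB' ⟨h1, ?_⟩⟩
    rw [Function.iterate_succ_apply', douglasRachford_eq, projOnto_of_mem hA hA' h0, two_smul,
      add_sub_cancel_right, add_sub_cancel_left]
    exact projOnto_mem ⟨p, hp.2⟩ hB hB' _
  · have hn := mem_interior_iff_mem_nhds.1 hint
    have hAne : A.Nonempty := ⟨p, hp.1⟩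
    have hrefl : Filter.Tendsto (fun n => (2 : ℝ) • projOnto A ((douglasRachford A B)^[n] x) -
        (douglasRachford A B)^[n] x) Filter.atTop (nhds p) := by
      have hP : FirmlyNonexpansive (projOnto A) := projOnto_firmlyNonexpansive hAne hA hA'
      have h := (((hP.continuous.tendsto p).comp hlim).const_smul (2 : ℝ)).sub hlim
      rwa [projOnto_of_mem hA hA' hp.1, two_smul, add_sub_cancel_right] at h
    obtain ⟨n, h0, h1⟩ := ((hrefl.eventually_mem hn).and (hlim1.eventually_mem hn)).exists
    simp only [Function.comp_apply] at h1
    refine ⟨n + 1, douglasRachford_of_mem_inter hA hA' hB hB' ⟨?_, h1⟩⟩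
    rw [Function.iterate_succ_apply', douglasRachford_eq, projOnto_of_mem hB hB' h0]
    have e : ∀ z w : E, z + ((2 : ℝ) • w - z) - w = w := fun z w => by module
    rw [e]
    exact projOnto_mem hAne hA hA' _

end Localisation

theorem corollary3 (A B : Set (EuclideanSpace ℝ (Fin 2)))
    (hA_closed : IsClosed A) (hA_convex : Convex ℝ A)
    (hB_closed : IsClosed B) (hB_convex : Convex ℝ B)
    (hAB : (A ∩ B).Nontrivial)
    (hpoly : ∀ x ∈ frontier A ∩ frontier B, IsPolyhedralAt A x ∧ IsPolyhedralAt B x)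
    (x₀ : EuclideanSpace ℝ (Fin 2)) :
    ∃ n : ℕ, (douglasRachford A B)^[n] x₀ ∈ Function.fixedPoints (douglasRachford A B) := by
  obtain ⟨z, hz⟩ := hAB.nonempty
  have hfirm : FirmlyNonexpansive (douglasRachford A B) :=
    douglasRachford_firmlyNonexpansive ⟨z, hz.1⟩ hA_closed hA_convex ⟨z, hz.2⟩ hB_closed hB_convex
  obtain ⟨xs, hxs, hlim⟩ := hfirm.exists_tendsto_iterate
    (douglasRachford_of_mem_inter hA_closed hA_convex hB_closed hB_convex hz) x₀
  rw [douglasRachford_eq_self_iff] at hxs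
  -- The limit is `p + v` with `v` normal to `A` at `p` and `-v` normal to `B` at `p`.
  obtain ⟨p, hpdef⟩ : ∃ p, projOnto A xs = p := ⟨_, rfl⟩
  obtain ⟨v, rfl⟩ : ∃ v, xs = p + v := ⟨xs - p, by abel⟩
  have hrefl : (2 : ℝ) • p - (p + v) = p - v := by module
  rw [hpdef, hrefl] at hxs
  have hpA : p ∈ A := hpdef ▸ projOnto_mem ⟨z, hz.1⟩ hA_closed hA_convex _
  have hpB : p ∈ B := by
    have h := projOnto_mem ⟨z, hz.2⟩ hB_closed hB_convex (p - v)
    rwa [hxs] at h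
  have hvA : ∀ w ∈ A, inner ℝ v (w - p) ≤ 0 := fun w hw => by
    have h := inner_sub_projOnto_le_zero hA_closed hA_convex (p + v) hw
    rwa [hpdef, add_sub_cancel_left] at h
  have hvB : ∀ w ∈ B, inner ℝ (-v) (w - p) ≤ 0 := fun w hw => by
    have h := inner_sub_projOnto_le_zero hB_closed hB_convex (p - v) hw
    rwa [hxs, sub_sub_cancel_left] at h
  by_cases hint : p ∈ interior A ∨ p ∈ interior B
  · have hv0 : v = 0 := by
      rcases hint with h | h
      · exact eq_zero_of_mem_interior h hvA
      · exact neg_eq_zero.1 (eq_zero_of_mem_interior h hvB)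
    rw [hv0, add_zero] at hlim
    exact exists_iterate_mem_fixedPoints_of_mem_interior hA_closed hA_convex hB_closed hB_convex
      ⟨hpA, hpB⟩ hint hlim
  obtain ⟨hintA, hintB⟩ := not_or.1 hint
  obtain ⟨hpolyA, hpolyB⟩ := hpoly p
    ⟨by rw [hA_closed.frontier_eq]; exact ⟨hpA, hintA⟩,
      by rw [hB_closed.frontier_eq]; exact ⟨hpB, hintB⟩⟩
  obtain ⟨q, hq, hqp⟩ := hAB.exists_ne p
  have hd0 : q - p ≠ 0 := sub_ne_zero.2 hqp
  have hvd : inner ℝ v (q - p) = 0 := by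
    have h := hvB q hq.2
    rw [inner_neg_left] at h
    linarith [hvA q hq.1]
  obtain ⟨K, hK, hdK, δ, hδ, hPK⟩ := exists_cone_projOnto_add hA_closed hA_convex hpA hpolyA hvA hd0
    (by rw [add_sub_cancel]; exact hq.1) hvd
  obtain ⟨L, hL, hdL, η, hη, hPL⟩ := exists_cone_projOnto_add hB_closed hB_convex hpB hpolyB hvB hd0
    (by rw [add_sub_cancel]; exact hq.2) (by rw [inner_neg_left, hvd, neg_zero])
  -- Near `p + v` the operator of `(A, B)` is a translate of the operator of the critical cones.
  have hlocal : ∀ y, ‖y‖ < min δ (η / 2) →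
      douglasRachford A B (p + v + y) = p + v + douglasRachford K L y := by
    intro y hy
    have e : (2 : ℝ) • (p + projOnto K y) - (p + v + y) =
        p + -v + ((2 : ℝ) • projOnto K y - y) := by module
    have hsmall : ‖(2 : ℝ) • projOnto K y - y‖ < η := by
      have e2 : (2 : ℝ) • projOnto K y - y = projOnto K y - (y - projOnto K y) := by module
      rw [e2]
      have h1 := norm_sub_le (projOnto K y) (y - projOnto K y)
      have h2 := hK.norm_projOnto_le y
      have h3 := hK.norm_sub_projOnto_le y
      have h4 := hy.trans_le (min_le_right _ _)
      linarith
    rw [douglasRachford_eq, douglasRachford_eq, hPK y (hy.trans_le (min_le_left _ _)), e,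
      hPL _ hsmall]
    abel
  have hy0 : Filter.Tendsto (fun n => (douglasRachford A B)^[n] x₀ - (p + v)) Filter.atTop
      (nhds 0) := by
    simpa using hlim.sub_const (p + v)
  obtain ⟨N, hN⟩ := Filter.eventually_atTop.1
    ((tendsto_zero_iff_norm_tendsto_zero.1 hy0).eventually_lt_const
      (lt_min hδ (half_pos hη)))
  have hstep : ∀ n, (douglasRachford A B)^[n + N + 1] x₀ - (p + v) =
      douglasRachford K L ((douglasRachford A B)^[n + N] x₀ - (p + v)) := fun n => by
    have h := hlocal _ (hN (n + N) (Nat.le_add_left N n))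
    rw [add_sub_cancel] at h
    rw [Function.iterate_succ_apply', h, add_sub_cancel_left]
  have hcone : IsConicalStep (douglasRachford K L) :=
    ⟨hK.douglasRachford_firmlyNonexpansive hL, fun c hc => hK.douglasRachford_smul hL hc,
      hK.inner_douglasRachford_sub hL⟩
  obtain ⟨n, hn⟩ := hcone.exists_map_eq_self
    (y := fun n => (douglasRachford A B)^[n + N] x₀ - (p + v))
    (fun n => by rw [← hstep n, Nat.add_right_comm])
    (hy0.comp (Filter.tendsto_add_atTop_nat N)) hd0
    (douglasRachford_of_mem_inter hK.isClosed hK.convex hL.isClosed hL.convex ⟨hdK, hdL⟩)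
  refine ⟨n + N, ?_⟩
  rw [← hstep n, sub_left_inj, Function.iterate_succ_apply'] at hn
  exact hn
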